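/- Let $\mathcal H$ be a complex Hilbert space, with inner product linear in the first argument. Let $E$ be a spectral (projection-valued) measure on the Borel subsets of $\mathbb R$ acting on $\mathcal H$, and let $H=\int_{\mathbb R}\lambda\,dE(\lambda)$ be the self-adjoint operator with spectral measure $E$. For $z\in\mathbb C$ write $e^{zH}:=\int_{\mathbb R}e^{z\lambda}\,dE(\lambda)$, an operator with domain $\mathcal D(e^{zH})$; for a measurable function $f$, the operator $\int f\,dE$ has domain $\{x\in\mathcal H : \int|f|^2\,dE^x<\infty\}$, where $E^x:=\langle E(\cdot)x,x\rangle$. Let $U_t=e^{itH}$, $t\in\mathbb R$, be the corresponding unitary one-parameter group, let $v\in\mathcal H$ and $\beta>0$, and put $\phi(t):=\langle U_tv,v\rangle$ for $t\in\mathbb R$. Write $\mathcal D_\beta=\{z\in\mathbb C: 0<\operatorname{Im}z<\beta\}$ and $\overline{\mathcal D_\beta}=\{z\in\mathbb C: 0\le\operatorname{Im}z\le\beta\}$. Then $\phi(t)=\int_{\mathbb R}e^{it\lambda}\,dE^v(\lambda)$ for all $t\in\mathbb R$, and the following are equivalent: (i) There exists a continuous function $\psi:\overline{\mathcal D_\beta}\to\mathbb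 C$, holomorphic on $\mathcal D_\beta$, such that $\psi|_{\mathbb R}=\phi$. (ii) $\int_{\mathbb R}e^{-\beta\lambda}\,dE^v(\lambda)<\infty$. (iii) $v\in\mathcal D(e^{-\frac{\beta}{2}H})$. -/

import Mathlib

open MeasureTheory Filter Topology
open scoped ENNReal InnerProductSpace

noncomputable section

/-- A spectral measure (projection-valued measure) on the Borel sets of the real line, acting on a
complex Hilbert space: every Borel set is mapped to an orthogonal projection, `E(ℝ) = 1`,
`E(s ∩ t) = E(s) E(t)`, and `E` is countably additive in the strong operator topology.
Values on non-measurable sets are unconstrained and are never used. -/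
structure SpectralMeasure (𝓗 : Type*) [NormedAddCommGroup 𝓗] [InnerProductSpace ℂ 𝓗]
    [CompleteSpace 𝓗] where
  proj : Set ℝ → 𝓗 →L[ℂ] 𝓗
  isStarProjection : ∀ s, MeasurableSet s → IsStarProjection (proj s)
  proj_univ : proj Set.univ = 1
  proj_inter : ∀ s t, MeasurableSet s → MeasurableSet t → proj (s ∩ t) = proj s * proj t
  hasSum_iUnion : ∀ s : ℕ → Set ℝ, (∀ i, MeasurableSet (s i)) →
    Pairwise (Function.onFun Disjoint s) → ∀ x : 𝓗,
      HasSum (fun i => proj (s i) x) (proj (⋃ i, s i) x)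

namespace SpectralMeasure

variable {𝓗 : Type*} [NormedAddCommGroup 𝓗] [InnerProductSpace ℂ 𝓗] [CompleteSpace 𝓗]
variable (E : SpectralMeasure 𝓗)

theorem proj_empty : E.proj ∅ = 0 := by
  ext x
  have h := E.hasSum_iUnion (fun _ => ∅) (fun _ => MeasurableSet.empty)
    (fun _ _ _ => disjoint_bot_left) x
  simpa using (summable_const_iff _).1 h.summable

theorem proj_union {s t : Set ℝ} (hs : MeasurableSet s) (ht : MeasurableSet t)
    (hd : Disjoint s t) : E.proj (s ∪ t) = E.proj s + E.proj t := by
  ext x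
  let u : ℕ → Set ℝ := fun i => if i = 0 then s else if i = 1 then t else ∅
  have hu : (⋃ i, u i) = s ∪ t := by
    ext y
    simp only [Set.mem_iUnion, Set.mem_union, u]
    constructor
    · rintro ⟨i, hi⟩
      split_ifs at hi
      · exact Or.inl hi
      · exact Or.inr hi
      · exact hi.elim
    · rintro (h | h)
      · exact ⟨0, by simpa using h⟩
      · exact ⟨1, by simpa using h⟩
  have h := E.hasSum_iUnion u
    (fun i => by simp only [u]; split_ifs <;> first | assumption | exact MeasurableSet.empty)
    (fun i j hij => by
      simp only [Function.onFun, u]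
      split_ifs
      · omega
      · exact hd
      · exact disjoint_bot_right
      · exact hd.symm
      · omega
      · exact disjoint_bot_right
      · exact disjoint_bot_left
      · exact disjoint_bot_left
      · exact disjoint_bot_left) x
  rw [hu] at h
  have h2 : HasSum (fun i => E.proj (u i) x) (∑ i ∈ Finset.range 2, E.proj (u i) x) := by
    apply hasSum_sum_of_ne_finset_zero
    intro i hi
    have h0 : i ≠ 0 := by rintro rfl; simp at hi
    have h1 : i ≠ 1 := by rintro rfl; simp at hi
    simp [u, h0, h1, E.proj_empty]
  have h3 := h.unique h2
  simpa [Finset.sum_range_succ, u] using h3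

theorem inner_proj {s : Set ℝ} (hs : MeasurableSet s) (x : 𝓗) :
    ⟪x, E.proj s x⟫_ℂ = ((‖E.proj s x‖ ^ 2 : ℝ) : ℂ) := by
  have h := E.isStarProjection s hs
  have h1 : E.proj s (E.proj s x) = E.proj s x := by
    have := congrArg (fun T : 𝓗 →L[ℂ] 𝓗 => T x) h.isIdempotentElem.eq
    simpa using this
  have h2 : ContinuousLinearMap.adjoint (E.proj s) = E.proj s := h.isSelfAdjoint
  calc ⟪x, E.proj s x⟫_ℂ = ⟪x, E.proj s (E.proj s x)⟫_ℂ := by rw [h1]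
    _ = ⟪ContinuousLinearMap.adjoint (E.proj s) x, E.proj s x⟫_ℂ :=
        (ContinuousLinearMap.adjoint_inner_left _ _ _).symm
    _ = ⟪E.proj s x, E.proj s x⟫_ℂ := by rw [h2]
    _ = _ := by rw [inner_self_eq_norm_sq_to_K]; norm_cast

/-- The finite positive Borel measure `E^x = ⟨E(·)x, x⟩` on the real line. -/
def measure (x : 𝓗) : Measure ℝ :=
  Measure.ofMeasurable (fun s _ => ENNReal.ofReal (⟪x, E.proj s x⟫_ℂ).re)
    (by simp [E.proj_empty])
    (by
      intro s hs hd
      have h := E.hasSum_iUnion s hs hd x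
      have h1 : HasSum (fun i => (⟪x, E.proj (s i) x⟫_ℂ).re) (⟪x, E.proj (⋃ i, s i) x⟫_ℂ).re :=
        Complex.hasSum_re (h.mapL (innerSL ℂ x))
      have h0 : ∀ i, 0 ≤ (⟪x, E.proj (s i) x⟫_ℂ).re := fun i => by
        rw [E.inner_proj (hs i), Complex.ofReal_re]; positivity
      rw [← h1.tsum_eq, ENNReal.ofReal_tsum_of_nonneg h0 h1.summable])

theorem measure_apply (x : 𝓗) {s : Set ℝ} (hs : MeasurableSet s) :
    E.measure x s = ENNReal.ofReal (⟪x, E.proj s x⟫_ℂ).re :=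
  Measure.ofMeasurable_apply s hs

theorem measure_apply_eq_enorm (x : 𝓗) {s : Set ℝ} (hs : MeasurableSet s) :
    E.measure x s = ‖E.proj s x‖ₑ ^ 2 := by
  rw [E.measure_apply x hs, E.inner_proj hs, Complex.ofReal_re, ENNReal.ofReal_pow (norm_nonneg _),
    ofReal_norm]

instance (x : 𝓗) : IsFiniteMeasure (E.measure x) :=
  ⟨by rw [E.measure_apply x MeasurableSet.univ]; exact ENNReal.ofReal_lt_top⟩

/-- The operator `∫ g dE = ∑ c, c • E({g = c})` for a simple function `g`. -/
def simpleIntegral (g : SimpleFunc ℝ ℂ) : 𝓗 →L[ℂ] 𝓗 :=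
  ∑ c ∈ g.range, c • E.proj (g ⁻¹' {c})

theorem simpleIntegral_sub (f g : SimpleFunc ℝ ℂ) :
    E.simpleIntegral (f - g) = E.simpleIntegral f - E.simpleIntegral g := by
  let T : Set ℝ → ℂ →L[ℝ] (𝓗 →L[ℂ] 𝓗) := fun s =>
    (ContinuousLinearMap.toSpanSingleton ℂ (E.proj s)).restrictScalars ℝ
  have hT : FinMeasAdditive (0 : Measure ℝ) T := by
    intro s t hs ht _ _ hd
    ext c : 1
    simp [T, E.proj_union hs ht hd]
  have key : ∀ g : SimpleFunc ℝ ℂ, E.simpleIntegral g = SimpleFunc.setToSimpleFunc T g := by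
    intro g
    simp [simpleIntegral, SimpleFunc.setToSimpleFunc, T]
  rw [key, key, key]
  exact SimpleFunc.setToSimpleFunc_sub T hT integrable_zero_measure integrable_zero_measure

theorem norm_simpleIntegral_sq (g : SimpleFunc ℝ ℂ) (x : 𝓗) :
    ‖E.simpleIntegral g x‖ₑ ^ 2 = ∫⁻ s, ‖g s‖ₑ ^ 2 ∂(E.measure x) := by
  have horth : ∀ c ∈ g.range, ∀ d ∈ g.range, c ≠ d →
      ⟪c • E.proj (g ⁻¹' {c}) x, d • E.proj (g ⁻¹' {d}) x⟫_ℂ = 0 := by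
    intro c _ d _ hcd
    have hc := g.measurableSet_fiber c
    have hd := g.measurableSet_fiber d
    have h2 : ContinuousLinearMap.adjoint (E.proj (g ⁻¹' {c})) = E.proj (g ⁻¹' {c}) :=
      (E.isStarProjection _ hc).isSelfAdjoint
    have h3 : E.proj (g ⁻¹' {c}) (E.proj (g ⁻¹' {d}) x) = 0 := by
      have h4 := E.proj_inter _ _ hc hd
      have h5 : g ⁻¹' {c} ∩ g ⁻¹' {d} = ∅ := by
        ext y
        simp only [Set.mem_inter_iff, Set.mem_preimage, Set.mem_singleton_iff, Set.mem_empty_iff_false,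
          iff_false, not_and]
        rintro rfl h
        exact hcd h
      rw [h5, E.proj_empty] at h4
      have := congrArg (fun T : 𝓗 →L[ℂ] 𝓗 => T x) h4
      simpa using this.symm
    rw [inner_smul_left, inner_smul_right]
    nth_rewrite 1 [← h2]
    rw [ContinuousLinearMap.adjoint_inner_left, h3]
    simp
  have hsum : ‖E.simpleIntegral g x‖ ^ 2
      = ∑ c ∈ g.range, ‖c • E.proj (g ⁻¹' {c}) x‖ ^ 2 := by
    have h : ((‖E.simpleIntegral g x‖ ^ 2 : ℝ) : ℂ)
        = ((∑ c ∈ g.range, ‖c • E.proj (g ⁻¹' {c}) x‖ ^ 2 : ℝ) : ℂ) := by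
      push_cast
      have e : ∀ y : 𝓗, ((‖y‖ : ℂ)) ^ 2 = ⟪y, y⟫_ℂ := fun y =>
        (inner_self_eq_norm_sq_to_K (𝕜 := ℂ) y).symm
      simp only [e]
      simp only [simpleIntegral, FunLike.coe_sum, Finset.sum_apply,
        FunLike.coe_smul, Pi.smul_apply]
      rw [sum_inner]
      refine Finset.sum_congr rfl fun c hc => ?_
      rw [inner_sum]
      refine Finset.sum_eq_single c (fun d hd hdc => horth c hc d hd hdc.symm) ?_
      intro h
      exact (h hc).elim
    exact_mod_cast h
  have h1 : ∫⁻ s, ‖g s‖ₑ ^ 2 ∂(E.measure x)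
      = (g.map (fun c => ‖c‖ₑ ^ 2)).lintegral (E.measure x) := by
    rw [← SimpleFunc.lintegral_eq_lintegral]; rfl
  rw [h1, SimpleFunc.map_lintegral, ← ofReal_norm, ← ENNReal.ofReal_pow (norm_nonneg _), hsum,
    ENNReal.ofReal_sum_of_nonneg (fun _ _ => by positivity)]
  refine Finset.sum_congr rfl fun c _ => ?_
  rw [E.measure_apply_eq_enorm x (g.measurableSet_fiber c), ENNReal.ofReal_pow (norm_nonneg _),
    ofReal_norm, enorm_smul, mul_pow]

theorem enorm_simpleIntegral (g : SimpleFunc ℝ ℂ) (x : 𝓗) :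
    ‖E.simpleIntegral g x‖ₑ = eLpNorm g 2 (E.measure x) := by
  rw [eLpNorm_eq_lintegral_rpow_enorm_toReal (by norm_num) (by norm_num)]
  have h := E.norm_simpleIntegral_sq g x
  simp only [ENNReal.toReal_ofNat, ENNReal.rpow_ofNat]
  rw [← h, ← ENNReal.rpow_natCast, ← ENNReal.rpow_mul]
  norm_num

/-- Approximation of a measurable function `f` by simple functions `fₙ` with `|fₙ| ≤ 2 |f|`
and `fₙ → f` pointwise. -/
def approx (f : ℝ → ℂ) (hf : Measurable f) (n : ℕ) : SimpleFunc ℝ ℂ :=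
  SimpleFunc.approxOn f hf Set.univ 0 (Set.mem_univ 0) n

theorem tendsto_approx (f : ℝ → ℂ) (hf : Measurable f) {x : 𝓗} (hx : MemLp f 2 (E.measure x)) :
    Tendsto (fun n => eLpNorm (⇑(approx f hf n) - f) 2 (E.measure x)) atTop (𝓝 0) :=
  SimpleFunc.tendsto_approxOn_Lp_eLpNorm hf (Set.mem_univ 0) (by norm_num) (by simp)
    (by simpa using hx.2)

/-- The vectors `∫ fₙ dE x` converge as soon as `f` is square-integrable for `E^x`. -/
theorem exists_tendsto_simpleIntegral (f : ℝ → ℂ) (hf : Measurable f) {x : 𝓗}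
    (hx : MemLp f 2 (E.measure x)) :
    ∃ y, Tendsto (fun n => E.simpleIntegral (approx f hf n) x) atTop (𝓝 y) := by
  apply cauchySeq_tendsto_of_complete
  rw [EMetric.cauchySeq_iff]
  intro ε hε
  have h := E.tendsto_approx f hf hx
  have hε2 : 0 < ε / 2 := ENNReal.half_pos hε.ne'
  obtain ⟨N, hN⟩ := eventually_atTop.1 (h.eventually (gt_mem_nhds hε2))
  refine ⟨N, fun m hm n hn => ?_⟩
  have e : E.simpleIntegral (approx f hf m) x - E.simpleIntegral (approx f hf n) x
      = E.simpleIntegral (approx f hf m - approx f hf n) x := by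
    rw [simpleIntegral_sub]; rfl
  rw [edist_eq_enorm_sub, e, enorm_simpleIntegral]
  have e2 : ⇑(approx f hf m - approx f hf n)
      = (⇑(approx f hf m) - f) - (⇑(approx f hf n) - f) := by
    ext s; simp
  rw [e2]
  have hm1 : AEStronglyMeasurable (⇑(approx f hf m) - f) (E.measure x) :=
    ((approx f hf m).measurable.sub hf).aestronglyMeasurable
  have hn1 : AEStronglyMeasurable (⇑(approx f hf n) - f) (E.measure x) :=
    ((approx f hf n).measurable.sub hf).aestronglyMeasurable
  calc _ ≤ _ := eLpNorm_sub_le hm1 hn1 (by norm_num)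
    _ < ε / 2 + ε / 2 := ENNReal.add_lt_add (hN m hm) (hN n hn)
    _ = ε := ENNReal.add_halves ε

theorem measure_add_le (x y : 𝓗) :
    E.measure (x + y) ≤ (2 : ℝ≥0∞) • (E.measure x + E.measure y) := by
  refine Measure.le_intro fun s hs _ => ?_
  simp only [Measure.smul_apply, Measure.add_apply, smul_eq_mul, E.measure_apply_eq_enorm _ hs,
    map_add]
  have h : ‖E.proj s x + E.proj s y‖ ^ 2 ≤ 2 * (‖E.proj s x‖ ^ 2 + ‖E.proj s y‖ ^ 2) := by
    have := norm_add_le (E.proj s x) (E.proj s y)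
    have h0 := norm_nonneg (E.proj s x + E.proj s y)
    nlinarith [sq_nonneg (‖E.proj s x‖ - ‖E.proj s y‖)]
  have h' := ENNReal.ofReal_le_ofReal h
  rw [ENNReal.ofReal_mul (by norm_num), ENNReal.ofReal_add (by positivity) (by positivity)] at h'
  simpa [ENNReal.ofReal_pow (norm_nonneg _), ofReal_norm] using h'

theorem measure_smul (c : ℂ) (x : 𝓗) : E.measure (c • x) = (‖c‖ₑ ^ 2) • E.measure x := by
  refine Measure.ext fun s hs => ?_
  simp [E.measure_apply_eq_enorm _ hs, enorm_smul, mul_pow]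

/-- The domain `{x | ∫ |f|² dE^x < ∞}` of the operator `∫ f dE`. -/
def integralDomain (f : ℝ → ℂ) : Submodule ℂ 𝓗 where
  carrier := {x | MemLp f 2 (E.measure x)}
  zero_mem' := by
    have : E.measure 0 = 0 := by simpa using E.measure_smul 0 0
    simp [this]
  add_mem' {x y} hx hy :=
    MemLp.of_measure_le_smul (by norm_num) (E.measure_add_le x y) (by
      have h1 := hx.integrable_norm_pow two_ne_zero
      have h2 := hy.integrable_norm_pow two_ne_zero
      exact (memLp_two_iff_integrable_sq_norm (hx.1.add_measure hy.1)).2 (h1.add_measure h2))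
  smul_mem' c x hx := by
    change MemLp f 2 (E.measure (c • x))
    rw [E.measure_smul]
    change MemLp f 2 (E.measure x) at hx
    exact hx.smul_measure (by finiteness)

/-- The (in general unbounded) operator `∫ f dE` of the spectral calculus: its domain is
`{x | ∫ |f|² dE^x < ∞}`, and there it sends `x` to the limit of the vectors `∫ fₙ dE x`, where
the simple functions `fₙ` converge to `f` in `L²(E^x)`. -/
def integral (f : ℝ → ℂ) (hf : Measurable f) : 𝓗 →ₗ.[ℂ] 𝓗 where
  domain := E.integralDomain f
  toFun :=
    { toFun := fun x => limUnder atTop (fun n => E.simpleIntegral (approx f hf n) (x : 𝓗))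
      map_add' := fun x y => by
        have hx := tendsto_nhds_limUnder (E.exists_tendsto_simpleIntegral f hf x.2)
        have hy := tendsto_nhds_limUnder (E.exists_tendsto_simpleIntegral f hf y.2)
        refine Tendsto.limUnder_eq ?_
        simpa using hx.add hy
      map_smul' := fun c x => by
        have hx := tendsto_nhds_limUnder (E.exists_tendsto_simpleIntegral f hf x.2)
        refine Tendsto.limUnder_eq ?_
        simpa using hx.const_smul c }

theorem mem_integral_domain (f : ℝ → ℂ) (hf : Measurable f) (x : 𝓗) :
    x ∈ (E.integral f hf).domain ↔ MemLp f 2 (E.measure x) := Iff.rfl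

theorem tendsto_integral (f : ℝ → ℂ) (hf : Measurable f) (x : (E.integral f hf).domain) :
    Tendsto (fun n => E.simpleIntegral (approx f hf n) (x : 𝓗)) atTop (𝓝 (E.integral f hf x)) :=
  tendsto_nhds_limUnder (E.exists_tendsto_simpleIntegral f hf x.2)

/-- `E` is the spectral measure of the operator `H`, that is `H = ∫ s dE(s)`
(as unbounded operators, with equal domains). -/
def IsSpectralMeasureOf (H : 𝓗 →ₗ.[ℂ] 𝓗) : Prop :=
  H = E.integral (fun s : ℝ => (s : ℂ)) Complex.measurable_ofReal

variable {E}

/-- The operator `e^{zH} = ∫ e^{zs} dE(s)` given by the functional calculus of the self-adjoint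
operator `H` with spectral measure `E`. -/
def expOperator {H : 𝓗 →ₗ.[ℂ] 𝓗} (_hE : E.IsSpectralMeasureOf H) (z : ℂ) : 𝓗 →ₗ.[ℂ] 𝓗 :=
  E.integral (fun s : ℝ => Complex.exp (z * s))
    (Complex.measurable_exp.comp (Complex.measurable_ofReal.const_mul z))

end SpectralMeasure

/-- The open strip `{z | 0 < Im z < β}`. -/
def openStrip (β : ℝ) : Set ℂ := {z | 0 < z.im ∧ z.im < β}

/-- The closed strip `{z | 0 ≤ Im z ≤ β}`. -/
def closedStrip (β : ℝ) : Set ℂ := {z | 0 ≤ z.im ∧ z.im ≤ β}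

end

/-! Put `μ = E^v`. Then `φ` is the characteristic function of `μ`, and everything is a statement
about `∫ e^{izs} dμ`. Since `|e^{-βs/2}|² = e^{-βs}`, (ii) and (iii) say the same thing. If (ii)
holds, `1 + e^{-βs}` dominates `|e^{izs}|` on the closed strip, so `∫ e^{izs} dμ` is the extension.

The content is (i) → (ii). Split `μ` at `0`. The transform `P` of the part on `[0, ∞)` lives on the
closed upper half-plane, the transform `N` of the part on `(-∞, 0)` on the closed lower one, and `ψ
- P = N` on the real line. Gluing gives a function that is continuous on `Im z < β` and, by Morera
(`differentiableOn_of_continuousOn_of_im_ne_zero`), holomorphic there. Pringsheim's argument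
(`lintegral_exp_eq_of_differentiableOn_ball`) turns this continuation of a Laplace transform of a
positive measure into convergence of the integral for every exponent `b < β`. Continuity of `ψ` at
`iβ` and Fatou's lemma give `b = β`. -/

/-! ### Holomorphy across the real line -/

open Complex in
/-- A continuous function that is holomorphic off the real line is holomorphic. -/
theorem differentiableOn_of_continuousOn_of_im_ne_zero {U : Set ℂ} (hU : IsOpen U) {f : ℂ → ℂ}
    (hc : ContinuousOn f U) (hd : ∀ z ∈ U, z.im ≠ 0 → DifferentiableAt ℂ f z) :
    DifferentiableOn ℂ f U := by
  refine (isConservativeOn_and_continuousOn_iff_isDifferentiableOn hU).1 ⟨?_, hc⟩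
  intro z w hzw
  rw [← add_eq_zero_iff_eq_neg, wedgeIntegral_add_wedgeIntegral_eq]
  have hcr : ContinuousOn f (Set.uIcc z.re w.re ×ℂ Set.uIcc z.im w.im) := hc.mono hzw
  have aux : ∀ p q : ℝ, Set.uIcc p q ⊆ Set.uIcc z.im w.im →
      (0 : ℝ) ∉ Set.Ioo (min p q) (max p q) →
      (∫ x : ℝ in z.re..w.re, f (x + p * I)) - (∫ x : ℝ in z.re..w.re, f (x + q * I)) +
        I • (∫ y : ℝ in p..q, f (w.re + y * I)) -
        I • (∫ y : ℝ in p..q, f (z.re + y * I)) = 0 := by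
    intro p q hpq h0
    have := integral_boundary_rect_eq_zero_of_continuousOn_of_differentiableOn f
      (z.re + p * I) (w.re + q * I)
      (by
        refine hcr.mono ?_
        intro x hx
        have h1 := hx.1
        have h2 := hx.2
        simp only [Set.mem_preimage, add_re, ofReal_re, mul_re, I_re, mul_zero, ofReal_im, I_im,
          mul_one, sub_self, add_zero, add_im, mul_im, zero_add] at h1 h2
        exact ⟨h1, hpq h2⟩)
      (by
        intro x hx
        refine (hd x (hzw ?_) ?_).differentiableWithinAt
        · have h1 := hx.1
          have h2 := hx.2
          simp only [Set.mem_preimage, add_re, ofReal_re, mul_re, I_re, mul_zero, ofReal_im, I_im,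
            mul_one, sub_self, add_zero, add_im, mul_im, zero_add] at h1 h2
          exact ⟨Set.Ioo_subset_Icc_self h1, hpq (Set.Ioo_subset_Icc_self h2)⟩
        · have h2 := hx.2
          simp only [Set.mem_preimage, ofReal_re, I_re, mul_zero, ofReal_im, I_im, mul_one,
            add_zero, add_im, mul_im, zero_add] at h2
          intro h
          exact h0 (h ▸ h2))
    simpa using this
  -- A rectangle meeting the real axis is cut along it. Each piece has no real point in its
  -- interior, and the integrals over the cut cancel.
  by_cases h0 : (0 : ℝ) ∈ Set.uIcc z.im w.im
  · have h1 := aux z.im 0 (Set.uIcc_subset_uIcc_left h0) (by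
      intro h; rcases le_total z.im 0 with h' | h' <;> simp_all)
    have h2 := aux 0 w.im (Set.uIcc_subset_uIcc_right h0) (by
      intro h; rcases le_total w.im 0 with h' | h' <;> simp_all)
    have hi : ∀ c ∈ Set.uIcc z.re w.re, ∀ p q : ℝ, Set.uIcc p q ⊆ Set.uIcc z.im w.im →
        IntervalIntegrable (fun y : ℝ => f (c + y * I)) volume p q := by
      intro c hcm p q hpq
      refine ContinuousOn.intervalIntegrable (hcr.comp (by fun_prop) ?_)
      intro y hy
      constructor
      · simpa using hcm
      · simpa using hpq hy
    have e1 := intervalIntegral.integral_add_adjacent_intervals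
      (hi w.re Set.right_mem_uIcc z.im 0 (Set.uIcc_subset_uIcc_left h0))
      (hi w.re Set.right_mem_uIcc 0 w.im (Set.uIcc_subset_uIcc_right h0))
    have e2 := intervalIntegral.integral_add_adjacent_intervals
      (hi z.re Set.left_mem_uIcc z.im 0 (Set.uIcc_subset_uIcc_left h0))
      (hi z.re Set.left_mem_uIcc 0 w.im (Set.uIcc_subset_uIcc_right h0))
    rw [← e1, ← e2, smul_add, smul_add]
    linear_combination h1 + h2
  · exact aux _ _ subset_rfl fun h => h0 (Set.Ioo_subset_Icc_self h)

/-! ### Laplace transforms and strips -/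

open ProbabilityTheory in
/-- **Pringsheim's theorem** for Laplace transforms of measures on the negative half-line. -/
theorem lintegral_exp_eq_of_differentiableOn_ball {ν : Measure ℝ} (hν : ∀ᵐ x ∂ν, x ≤ 0)
    {c r : ℝ} (hc : c ∈ interior (integrableExpSet id ν)) {f : ℂ → ℂ}
    (hf : DifferentiableOn ℂ f (Metric.ball (c : ℂ) r))
    (hfc : f =ᶠ[𝓝 (c : ℂ)] complexMGF id ν) {y : ℝ} (hyc : y ≤ c) (hyr : c - y < r) :
    ∫⁻ x, ENNReal.ofReal (Real.exp (y * x)) ∂ν = ENNReal.ofReal (f y).re := by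
  -- The Taylor terms of `y ↦ e^{yx}` at `c`. They are nonnegative because `y - c ≤ 0` and `x ≤ 0`,
  -- so sum and integral may be exchanged with no prior bound at `y`.
  set g : ℕ → ℝ → ℝ := fun n x => (n.factorial : ℝ)⁻¹ * ((y - c) ^ n * (x ^ n * Real.exp (c * x)))
    with hg
  have hgint : ∀ n, Integrable (g n) ν := fun n =>
    ((integrable_pow_mul_exp_of_mem_interior_integrableExpSet hc n).const_mul _).const_mul _
  have hg0 : ∀ n, ∀ᵐ x ∂ν, 0 ≤ g n x := fun n => by
    filter_upwards [hν] with x hx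
    have : 0 ≤ (y - c) * x := mul_nonneg_of_nonpos_of_nonpos (by linarith) hx
    simp only [hg]
    rw [← mul_assoc ((y - c) ^ n), ← mul_pow]
    positivity
  have hsumg : ∀ x, HasSum (fun n => g n x) (Real.exp (y * x)) := fun x => by
    have h := NormedSpace.expSeries_div_hasSum_exp ((y - c) * x)
    rw [← Real.exp_eq_exp_ℝ] at h
    have h2 := h.mul_right (Real.exp (c * x))
    rw [← Real.exp_add] at h2
    have e1 : (fun n => g n x)
        = fun n => ((y - c) * x) ^ n / (n.factorial : ℝ) * Real.exp (c * x) := by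
      ext n
      simp only [hg]
      rw [mul_pow]
      ring
    rw [e1]
    convert! h2 using 2
    ring
  -- The Taylor coefficients of `f` at `c` are moments of `ν`, and its series converges on the whole
  -- disc, even where the transform is not yet known to exist.
  have hT : HasSum (fun n => ((∫ x, g n x ∂ν : ℝ) : ℂ)) (f y) := by
    have h := Complex.hasSum_taylorSeries_on_ball hf (z := (y : ℂ)) (by
      rw [Metric.mem_ball, Complex.dist_of_im_eq (by simp)]
      simp only [Complex.ofReal_re]
      rw [Real.dist_eq, abs_sub_comm, abs_of_nonneg (by linarith)]
      exact hyr)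
    convert! h using 1
    ext n
    rw [hfc.iteratedDeriv_eq n, iteratedDeriv_complexMGF (by simpa using hc)]
    have : (∫ x : ℝ, ((id x : ℝ) : ℂ) ^ n * Complex.exp (c * (id x : ℝ)) ∂ν)
        = ((∫ x, x ^ n * Real.exp (c * x) ∂ν : ℝ) : ℂ) := by
      rw [← integral_complex_ofReal]
      simp
    rw [this]
    simp only [hg, integral_const_mul]
    push_cast
    simp [smul_eq_mul]
  have hTr : HasSum (fun n => ∫ x, g n x ∂ν) (f y).re := by
    simpa using Complex.hasSum_re hT
  calc ∫⁻ x, ENNReal.ofReal (Real.exp (y * x)) ∂ν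
      = ∫⁻ x, ∑' n, ENNReal.ofReal (g n x) ∂ν := by
        refine lintegral_congr_ae ?_
        filter_upwards [ae_all_iff.2 hg0] with x hx
        rw [← (hsumg x).tsum_eq, ENNReal.ofReal_tsum_of_nonneg hx (hsumg x).summable]
    _ = ∑' n, ∫⁻ x, ENNReal.ofReal (g n x) ∂ν :=
        lintegral_tsum fun n => (hgint n).1.aemeasurable.ennreal_ofReal
    _ = ∑' n, ENNReal.ofReal (∫ x, g n x ∂ν) := by
        congr 1 with n
        rw [ofReal_integral_eq_lintegral_ofReal (hgint n) (hg0 n)]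
    _ = ENNReal.ofReal (f y).re := by
        rw [← hTr.tsum_eq, ENNReal.ofReal_tsum_of_nonneg
          (fun n => integral_nonneg_of_ae (hg0 n)) hTr.summable]

open ProbabilityTheory in
/-- The moment generating function is continuous wherever the exponentials are dominated. -/
theorem continuousOn_complexMGF_of_dominated {μ : Measure ℝ} {S : Set ℂ} {g : ℝ → ℝ}
    (hg : Integrable g μ) (h : ∀ z ∈ S, ∀ᵐ x ∂μ, Real.exp (z.re * x) ≤ g x) :
    ContinuousOn (complexMGF id μ) S := by
  refine continuousOn_of_dominated (bound := g) (fun z _ => ?_) (fun z hz => ?_) hg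
    (ae_of_all _ fun x => by fun_prop)
  · fun_prop
  · filter_upwards [h z hz] with x hx
    simpa [Complex.norm_exp] using hx

-- Multiplication by `i` carries the strip to `-β ≤ Re u ≤ 0`. There `|e^{us}|` is at most `1` for
-- `s ≥ 0` and at most `e^{-βs}` for `s ≤ 0`, which gives continuity up to both edges.
open ProbabilityTheory in
theorem continuousOn_differentiableOn_complexMGF_strip {μ : Measure ℝ} [IsFiniteMeasure μ] {β : ℝ}
    (h : Integrable (fun x => Real.exp (-β * x)) μ) :
    ContinuousOn (fun z => complexMGF id μ (Complex.I * z)) (closedStrip β) ∧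
      DifferentiableOn ℂ (fun z => complexMGF id μ (Complex.I * z)) (openStrip β) := by
  constructor
  · have : ContinuousOn (complexMGF id μ) {u | -β ≤ u.re ∧ u.re ≤ 0} := by
      refine continuousOn_complexMGF_of_dominated (h.add (integrable_const 1)) fun z hz => ?_
      refine ae_of_all _ fun x => ?_
      simp only [Pi.add_apply]
      rcases le_total 0 x with hx | hx
      · have : Real.exp (z.re * x) ≤ 1 :=
          Real.exp_le_one_iff.2 (mul_nonpos_of_nonpos_of_nonneg hz.2 hx)
        linarith [Real.exp_pos (-β * x)]
      · have : Real.exp (z.re * x) ≤ Real.exp (-β * x) :=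
          Real.exp_le_exp.2 (mul_le_mul_of_nonpos_right hz.1 hx)
        linarith
    refine this.comp (by fun_prop) fun z hz => ?_
    simpa [closedStrip, and_comm] using hz
  · refine DifferentiableOn.comp (g := complexMGF id μ) (f := fun z => Complex.I * z)
      (t := {z | z.re ∈ interior (integrableExpSet id μ)})
      differentiableOn_complexMGF (by fun_prop) fun z hz => ?_
    have hsub : Set.Ioo (-β) 0 ⊆ integrableExpSet id μ := fun t ht =>
      integrable_exp_mul_of_le_of_le (X := id) h (b := 0) (by simp) ht.1.le ht.2.le
    refine interior_maximal hsub isOpen_Ioo ?_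
    simpa [openStrip, and_comm] using hz

open ProbabilityTheory Complex in
/-- If the characteristic function of a finite measure extends holomorphically to a strip,
continuously up to the boundary, then the corresponding exponential moment is finite. -/
theorem lintegral_exp_lt_top_of_strip_extension {μ : Measure ℝ} [IsFiniteMeasure μ] {β : ℝ}
    (hβ : 0 < β) {ψ : ℂ → ℂ} (hc : ContinuousOn ψ (closedStrip β))
    (hd : DifferentiableOn ℂ ψ (openStrip β))
    (hψ : ∀ t : ℝ, ψ t = ∫ s : ℝ, cexp (I * t * s) ∂μ) :
    ∫⁻ s, ENNReal.ofReal (Real.exp (-β * s)) ∂μ < ∞ := by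
  set μp := μ.restrict (Set.Ici 0) with hμp
  set μn := μ.restrict (Set.Iio 0) with hμn
  have hp : ∀ᵐ x ∂μp, 0 ≤ x := ae_restrict_mem measurableSet_Ici
  have hn : ∀ᵐ x ∂μn, x ≤ 0 := by
    filter_upwards [ae_restrict_mem (μ := μ) measurableSet_Iio] with x hx using le_of_lt hx
  have hμ : μ = μp + μn := by
    rw [hμp, hμn, ← Set.compl_Ici, Measure.restrict_add_restrict_compl measurableSet_Ici]
  have bp : ∀ z : ℂ, z.re ≤ 0 → ∀ᵐ x ∂μp, Real.exp (z.re * x) ≤ 1 := fun z hz => by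
    filter_upwards [hp] with x hx
    exact Real.exp_le_one_iff.2 (mul_nonpos_of_nonpos_of_nonneg hz hx)
  have bn : ∀ z : ℂ, 0 ≤ z.re → ∀ᵐ x ∂μn, Real.exp (z.re * x) ≤ 1 := fun z hz => by
    filter_upwards [hn] with x hx
    exact Real.exp_le_one_iff.2 (mul_nonpos_of_nonneg_of_nonpos hz hx)
  have ip : ∀ t : ℝ, t ≤ 0 → Integrable (fun x => Real.exp (t * x)) μp := fun t ht =>
    (integrable_const (1 : ℝ)).mono' (by fun_prop) (by simpa using bp t (by simpa using ht))
  have in' : ∀ t : ℝ, 0 ≤ t → Integrable (fun x => Real.exp (t * x)) μn := fun t ht =>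
    (integrable_const (1 : ℝ)).mono' (by fun_prop) (by simpa using bn t (by simpa using ht))
  have sp : Set.Iio 0 ⊆ interior (integrableExpSet id μp) :=
    interior_maximal (fun t ht => ip t (le_of_lt ht)) isOpen_Iio
  have sn : Set.Ioi 0 ⊆ interior (integrableExpSet id μn) :=
    interior_maximal (fun t ht => in' t (le_of_lt ht)) isOpen_Ioi
  set P : ℂ → ℂ := fun z => complexMGF id μp (I * z) with hP
  set N : ℂ → ℂ := fun z => complexMGF id μn (I * z) with hN
  have cP : ContinuousOn P {z | 0 ≤ z.im} := by
    refine (continuousOn_complexMGF_of_dominated (S := {u | u.re ≤ 0}) (integrable_const 1)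
      (fun z hz => bp z hz)).comp (by fun_prop) fun z hz => ?_
    simpa using hz
  have cN : ContinuousOn N {z | z.im ≤ 0} := by
    refine (continuousOn_complexMGF_of_dominated (S := {u | 0 ≤ u.re}) (integrable_const 1)
      (fun z hz => bn z hz)).comp (by fun_prop) fun z hz => ?_
    simpa using hz
  have dP : ∀ z : ℂ, 0 < z.im → DifferentiableAt ℂ P z := fun z hz => by
    have h : DifferentiableAt ℂ (complexMGF id μp) (I * z) :=
      (analyticAt_complexMGF (sp (by simpa using hz))).differentiableAt
    exact h.comp z (by fun_prop)
  have dN : ∀ z : ℂ, z.im < 0 → DifferentiableAt ℂ N z := fun z hz => by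
    have h : DifferentiableAt ℂ (complexMGF id μn) (I * z) :=
      (analyticAt_complexMGF (sn (by simpa using hz))).differentiableAt
    exact h.comp z (by fun_prop)
  have hreal : ∀ z : ℂ, z.im = 0 → ψ z - P z = N z := fun z hz => by
    obtain ⟨t, rfl⟩ : ∃ t : ℝ, z = t := ⟨z.re, by apply Complex.ext <;> simp [hz]⟩
    rw [sub_eq_iff_eq_add', hψ, hμ]
    have hi : ∀ ν : Measure ℝ, IsFiniteMeasure ν →
        Integrable (fun s : ℝ => cexp (I * t * s)) ν := fun ν _ =>
      (integrable_const (1 : ℝ)).mono' (by fun_prop)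
        (ae_of_all _ fun x => by simp [Complex.norm_exp])
    exact integral_add_measure (hi _ inferInstance) (hi _ inferInstance)
  set F : ℂ → ℂ := fun z => if 0 ≤ z.im then ψ z - P z else N z with hF
  have hU : IsOpen {z : ℂ | z.im < β} := isOpen_lt Complex.continuous_im continuous_const
  have cF : ContinuousOn F {z : ℂ | z.im < β} := by
    refine ContinuousOn.if ?_ ?_ ?_
    · intro z hz
      have : z ∈ frontier {a : ℂ | 0 ≤ a.im} := hz.2
      rw [Complex.frontier_setOfPred_le_im] at this
      exact hreal z this
    · refine (hc.sub (cP.mono ?_)).mono ?_ (s := closedStrip β)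
      · exact fun z hz => hz.1
      · intro z hz
        have h2 := hz.2
        rw [(isClosed_le continuous_const Complex.continuous_im).closure_eq] at h2
        exact ⟨h2, le_of_lt hz.1⟩
    · refine cN.mono ?_
      intro z hz
      have h2 := hz.2
      simp only [not_le] at h2
      rw [Complex.closure_setOfPred_im_lt] at h2
      exact h2
  have dF : DifferentiableOn ℂ F {z : ℂ | z.im < β} := by
    refine differentiableOn_of_continuousOn_of_im_ne_zero hU cF fun z hz h0 => ?_
    rcases lt_or_gt_of_ne h0 with h | h
    · refine (dN z h).congr_of_eventuallyEq ?_
      filter_upwards [(isOpen_lt Complex.continuous_im continuous_const).mem_nhds h] with w hw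
      exact if_neg (not_le.2 hw)
    · have ho : IsOpen (openStrip β) :=
        (isOpen_lt continuous_const Complex.continuous_im).inter hU
      refine ((hd.differentiableAt (ho.mem_nhds ⟨h, hz⟩)).sub (dP z h)).congr_of_eventuallyEq ?_
      filter_upwards [(isOpen_lt continuous_const Complex.continuous_im).mem_nhds h] with w hw
      exact if_pos (le_of_lt hw)
  -- In the variable `u = iz`, `F` is holomorphic on `Re u > -β` and is the transform of `μn` for
  -- `Re u > 0`. The disc about `1` of radius `1 + β` stays in that half-plane and contains every
  -- `-b`.
  have key : ∀ b : ℝ, 0 ≤ b → b < β → ∫⁻ x, ENNReal.ofReal (Real.exp (-b * x)) ∂μn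
      = ENNReal.ofReal (ψ (b * I) - P (b * I)).re := by
    intro b hb hbβ
    have h := lintegral_exp_eq_of_differentiableOn_ball hn (c := 1) (r := 1 + β)
      (f := fun u => F (-I * u)) (sn (by simp)) ?_ ?_ (y := -b) (by linarith) (by linarith)
    · rw [h]
      have e : -I * ((-b : ℝ) : ℂ) = b * I := by push_cast; ring
      simp only [e]
      simp [hF, hb]
    · refine dF.comp (by fun_prop) fun u hu => ?_
      have h1 := (Complex.abs_re_le_norm (u - 1)).trans_lt (by simpa [dist_eq_norm] using hu)
      have h2 := (abs_lt.1 h1).1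
      simp only [sub_re, one_re] at h2
      simp only [Set.mem_ofPred_eq, neg_mul, neg_im, mul_im, I_re, I_im]
      linarith
    · have : {u : ℂ | 0 < u.re} ∈ 𝓝 ((1 : ℝ) : ℂ) :=
        (isOpen_lt continuous_const Complex.continuous_re).mem_nhds (by simp)
      filter_upwards [this] with u hu
      have hu' : 0 < u.re := hu
      simp [hF, hu', hN, ← mul_assoc]
  have hneg : ∫⁻ x, ENNReal.ofReal (Real.exp (-β * x)) ∂μn < ∞ := by
    set b : ℕ → ℝ := fun n => β - β / (n + 1) with hb
    have hb0 : ∀ n, 0 ≤ b n := fun n => by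
      have : β / ((n : ℝ) + 1) ≤ β := div_le_self hβ.le (by linarith [n.cast_nonneg (α := ℝ)])
      simp only [hb]; linarith
    have hbβ : ∀ n, b n < β := fun n => by
      have : 0 < β / ((n : ℝ) + 1) := by positivity
      simp only [hb]; linarith
    have hlim : Tendsto b atTop (𝓝 β) := by
      have := (tendsto_const_nhds (x := β)).sub
        ((tendsto_const_div_atTop_nhds_zero_nat β).comp (tendsto_add_atTop_nat 1))
      simpa [hb, Function.comp_def] using this
    have hcont : ContinuousOn (fun z => ψ z - P z) (closedStrip β) :=
      hc.sub (cP.mono fun z hz => hz.1)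
    have hT : Tendsto (fun n => ENNReal.ofReal (ψ (b n * I) - P (b n * I)).re) atTop
        (𝓝 (ENNReal.ofReal (ψ (β * I) - P (β * I)).re)) := by
      refine (ENNReal.continuous_ofReal.tendsto _).comp
        ((Complex.continuous_re.tendsto _).comp ?_)
      refine (hcont (β * I) ⟨by simpa using hβ.le, by simp⟩).tendsto.comp ?_
      refine tendsto_nhdsWithin_iff.2 ⟨?_, Eventually.of_forall fun n =>
        ⟨by simpa using hb0 n, by simpa using (hbβ n).le⟩⟩
      exact ((Complex.continuous_ofReal.tendsto β).comp hlim).mul_const I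
    -- Fatou's lemma along `b n → β`; the right-hand sides converge by continuity of `ψ - P` at
    -- `iβ`.
    calc ∫⁻ x, ENNReal.ofReal (Real.exp (-β * x)) ∂μn
        = ∫⁻ x, liminf (fun n => ENNReal.ofReal (Real.exp (-b n * x))) atTop ∂μn := by
          refine lintegral_congr fun x => ?_
          refine (Tendsto.liminf_eq ?_).symm
          refine (ENNReal.continuous_ofReal.tendsto _).comp
            ((Real.continuous_exp.tendsto _).comp (hlim.neg.mul_const x))
      _ ≤ liminf (fun n => ∫⁻ x, ENNReal.ofReal (Real.exp (-b n * x)) ∂μn) atTop :=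
          lintegral_liminf_le fun n => by fun_prop
      _ = ENNReal.ofReal (ψ (β * I) - P (β * I)).re := by
          simp only [fun n => key (b n) (hb0 n) (hbβ n)]
          exact hT.liminf_eq
      _ < ∞ := ENNReal.ofReal_lt_top
  rw [hμ, lintegral_add_measure]
  exact ENNReal.add_lt_top.2 ⟨(ip (-β) (by linarith)).lintegral_lt_top, hneg⟩

/-! ### Matrix coefficients of spectral integrals and the equivalence -/

namespace SpectralMeasure

variable {𝓗 : Type*} [NormedAddCommGroup 𝓗] [InnerProductSpace ℂ 𝓗] [CompleteSpace 𝓗]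

theorem inner_simpleIntegral (E : SpectralMeasure 𝓗) (g : SimpleFunc ℝ ℂ) (x : 𝓗) :
    ⟪x, E.simpleIntegral g x⟫_ℂ = ∫ s, g s ∂(E.measure x) := by
  rw [← SimpleFunc.integral_eq_integral g (SimpleFunc.integrable_of_isFiniteMeasure g),
    SimpleFunc.integral_eq]
  simp only [simpleIntegral, FunLike.coe_sum, Finset.sum_apply, FunLike.coe_smul, Pi.smul_apply,
    inner_sum, inner_smul_right]
  refine Finset.sum_congr rfl fun c _ => ?_
  have hm := g.measurableSet_fiber c
  rw [Measure.real, E.measure_apply x hm, E.inner_proj hm, Complex.ofReal_re,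
    ENNReal.toReal_ofReal (by positivity), Complex.real_smul, mul_comm]

/-- Passage to the limit from simple functions, dominated by `2|f|`; this is integrable since `E^x`
is finite and `f` is in `L²(E^x)`. -/
theorem inner_integral (E : SpectralMeasure 𝓗) (f : ℝ → ℂ) (hf : Measurable f)
    (x : (E.integral f hf).domain) :
    ⟪(x : 𝓗), E.integral f hf x⟫_ℂ = ∫ s, f s ∂(E.measure (x : 𝓗)) := by
  have hmem : MemLp f 2 (E.measure (x : 𝓗)) := x.2
  have hint : Integrable f (E.measure (x : 𝓗)) := hmem.integrable (by norm_num)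
  refine tendsto_nhds_unique
    ((innerSL ℂ (x : 𝓗)).continuous.tendsto _ |>.comp (E.tendsto_integral f hf x)) ?_
  simp only [Function.comp_def, innerSL_apply_apply, inner_simpleIntegral]
  refine tendsto_integral_of_dominated_convergence (fun s => ‖f s‖ + ‖f s‖)
    (fun n => (approx f hf n).measurable.aestronglyMeasurable) (hint.norm.add hint.norm)
    (fun n => ae_of_all _ fun s => SimpleFunc.norm_approxOn_zero_le hf _ s n)
    (ae_of_all _ fun s => SimpleFunc.tendsto_approxOn hf _ (by simp))

end SpectralMeasure

theorem LinearPMap.apply_eq_of_toPMap_top_eq {R M N : Type*} [Ring R] [AddCommGroup M]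
    [AddCommGroup N] [Module R M] [Module R N] {T : M →ₗ[R] N} {A : M →ₗ.[R] N}
    (h : T.toPMap ⊤ = A) (x : A.domain) : A x = T x := by
  subst h
  rfl

/-- The inner product `⟪·, ·⟫_ℂ` is linear in its second slot, hence the swapped order in `hφ`. -/
theorem lemmaB4 {𝓗 : Type*} [NormedAddCommGroup 𝓗] [InnerProductSpace ℂ 𝓗] [CompleteSpace 𝓗]
    (H : 𝓗 →ₗ.[ℂ] 𝓗) (E : SpectralMeasure 𝓗) (hE : E.IsSpectralMeasureOf H)
    (U : Multiplicative ℝ →* unitary (𝓗 →L[ℂ] 𝓗))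
    (hU : ∀ t : ℝ, LinearMap.toPMap ((U (Multiplicative.ofAdd t) : 𝓗 →L[ℂ] 𝓗) : 𝓗 →ₗ[ℂ] 𝓗) ⊤
      = SpectralMeasure.expOperator hE (Complex.I * t))
    (v : 𝓗) (β : ℝ) (hβ : 0 < β) (φ : ℝ → ℂ)
    (hφ : ∀ t : ℝ, φ t = ⟪v, (U (Multiplicative.ofAdd t) : 𝓗 →L[ℂ] 𝓗) v⟫_ℂ) :
    (∀ t : ℝ, φ t = ∫ s : ℝ, Complex.exp (Complex.I * t * s) ∂(E.measure v)) ∧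
    List.TFAE [
      ∃ ψ : ℂ → ℂ, ContinuousOn ψ (closedStrip β) ∧ DifferentiableOn ℂ ψ (openStrip β) ∧
        ∀ t : ℝ, ψ t = φ t,
      ∫⁻ s : ℝ, ENNReal.ofReal (Real.exp (-β * s)) ∂(E.measure v) < ∞,
      v ∈ (SpectralMeasure.expOperator hE (-(β / 2 : ℂ))).domain] := by
  have hφ' : ∀ t : ℝ, φ t = ∫ s : ℝ, Complex.exp (Complex.I * t * s) ∂(E.measure v) := fun t => by
    have hv : v ∈ (SpectralMeasure.expOperator hE (Complex.I * t)).domain := by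
      rw [← hU t]
      exact Submodule.mem_top
    have h1 := LinearPMap.apply_eq_of_toPMap_top_eq (hU t) ⟨v, hv⟩
    have h2 := E.inner_integral _ _ ⟨v, hv⟩
    rw [hφ t]
    refine Eq.trans ?_ h2
    exact congrArg (fun w => ⟪v, w⟫_ℂ) h1.symm
  refine ⟨hφ', ?_⟩
  tfae_have 1 → 2 := by
    rintro ⟨ψ, hc, hd, hψ⟩
    exact lintegral_exp_lt_top_of_strip_extension hβ hc hd fun t => (hψ t).trans (hφ' t)
  tfae_have 2 → 1 := by
    intro h
    have hi : Integrable (fun s => Real.exp (-β * s)) (E.measure v) := by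
      refine ⟨by fun_prop, ?_⟩
      rw [hasFiniteIntegral_iff_ofReal (ae_of_all _ fun s => (Real.exp_pos _).le)]
      exact h
    obtain ⟨h1, h2⟩ := continuousOn_differentiableOn_complexMGF_strip hi
    exact ⟨_, h1, h2, fun t => (hφ' t).symm⟩
  tfae_have 3 ↔ 2 := by
    refine (SpectralMeasure.mem_integral_domain _ _ _ _).trans ?_
    rw [memLp_two_iff_integrable_sq_norm (by fun_prop)]
    have e : (fun s : ℝ => ‖Complex.exp (-(β / 2 : ℂ) * s)‖ ^ 2)
        = fun s => Real.exp (-β * s) := by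
      ext s
      rw [Complex.norm_exp, ← Real.exp_nat_mul]
      congr 1
      have : (-(β / 2 : ℂ) * s) = ((-(β / 2) * s : ℝ) : ℂ) := by push_cast; ring
      rw [this, Complex.ofReal_re]
      push_cast
      ring
    rw [e, Integrable, and_iff_right (by fun_prop),
      hasFiniteIntegral_iff_ofReal (ae_of_all _ fun s => (Real.exp_pos _).le)]
  tfae_finish
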